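/- **Setting.** Let $N=N(n)$ be a bound on the entries of the data, let $1\le k\le n$, and let $\mathcal A_0$ be a deterministic relaxed $k$-sparse recovery algorithm given by a linear measurement $\Phi_n:\mathbb Z^n\to(\mathbb Z/p)^m$ ($p=0$ meaning integer measurements): it has a program computing $\Phi_n$ and a program $\mathsf{Report}$ with values in $[-N,N]^n$ such that $\mathsf{Report}(\Phi_n(\vec x))=\vec x$ whenever $\vec x\in[-N,N]^n$ has at most $k$ non-zero entries. Vectors in $\mathbb Z^n$ are stored as lists of their non-zero entries. Running times $\mathcal R(\cdot)$ are counted in bit operations, where arithmetic on $b$-bit numbers is done by schoolbook methods; sizes are in bits. GSW has parameters $(g,h,q,\sigma)$ depending on the security parameter $\lambda$, with $g=\lambda$, $h=\Theta(g\log q)$ and $h\ge(g+1)\lceil\log q\rceil$. Its public keys and ciphertexts are matrices in $\mathbb Z_q^{(g+1)\times h}$; with $G$ the gadget matrix and $G^{-1}(\cdot)$ bit decomposition, it evaluates $1\mapsto G$, $1-\mu\mapsto G-C$, $\mu\mu'\mapsto C\,G^{-1}(C')$. Write $\lambda=\mathcal S(n)$ and assume that $q=q(\mathcal S(n))$ is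 polynomially bounded in $n$ and $q>nN$. **Protocol.** The state $\zeta$ consists of a public key and $\ell=\lceil\log n\rceil$ ciphertexts, all uniformly random matrices, and is sent to all servers. Let $\hat{\mathsf{ct}}_i$ be the GSW evaluation on these ciphertexts of the circuit $C_i$ which outputs $1$ exactly on the bit representation of $i$. A server holding $\vec x_t$ sends $(\sum_i(\vec x_t)_i\,\hat{\mathsf{ct}}_i,\ \Phi_n(\vec x_t))$. The coordinator adds up the $T$ packets, computes $\vec x'=\mathsf{Report}(\sum_t\Phi_n(\vec x_t))$, answers $\bot$ if $\vec x'$ has more than $k$ non-zero entries, and otherwise answers $\vec x'$ if $\sum_i\vec x'_i\,\hat{\mathsf{ct}}_i$ equals the sum of the sketches, and $\bot$ if not. Ciphertexts $\hat{\mathsf{ct}}_i$ are evaluated only for the non-zero coordinates of the vector at hand. $\tilde{\mathcal O}(f)$ means at most $C(\log n)^d f$ for all $n\ge 2$, where the constants $C,d$ do not depend on $n,k,T$, $\mathcal A_0$, $\zeta$ or the data. **Proposition.** For every state $\zeta$ and all $\vec x_1,\dots,\vec x_T\in\mathbb Z^n$ all of whose subset sums lie in $[-N,N]^n$, and all $B$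 with $\mathrm{size}(\Phi_n(\vec z))\le B$ for every $\vec z\in[-N,N]^n$, the protocol can be run by programs with the following costs. * Suppose LWE with these parameters is subexponentially hard: for some $\beta,c>0$ and all large $\lambda$, Boolean circuits of size at most $2^{\lambda^\beta}$ have distinguishing advantage at most $2^{-\lambda^c}$. Let $\lambda=\lceil\log^r n\rceil$ with $r>1/\beta$ and $r>1/c$. Then: 1. the communication between the coordinator and a server holding $\vec x$ is $\tilde{\mathcal O}(1)+\mathrm{size}(\Phi_n(\vec x))$; 2. $\mathcal R(\mathsf{Coordinator})\le\tilde{\mathcal O}(k)+\mathcal R(\mathsf{Report})$ plus the cost of adding up the $T$ packets, which is $\tilde{\mathcal O}(T)+2TB$; 3. $\mathcal R(\mathsf{Server})\le\tilde{\mathcal O}(n)+\mathcal R(\Phi_n(\vec x))$ for every $\vec x\in[-N,N]^n$, and $\mathcal R(\mathsf{Server})\le\tilde{\mathcal O}(k)+\mathcal R(\Phi_n(\vec x))$ if $\vec x$ has at most $k$ non-zero entries. * For all $w_1,w_2,w_3>0$ there is $w_0>0$ such that for every $0<w\le w_0$ and $\lambda=\lceil n^{w}\rceil$ the following holds. Suppose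 LWE with these parameters is polynomially hard (non-uniform adversaries of polynomial size have negligible advantage). Then: 1. the communication is $\tilde{\mathcal O}(n^{w_1})+\mathrm{size}(\Phi_n(\vec x))$; 2. $\mathcal R(\mathsf{Coordinator})\le\tilde{\mathcal O}(k\,n^{w_2})+\mathcal R(\mathsf{Report})$ plus the cost of adding up the packets, which is $\tilde{\mathcal O}(T\,n^{w_2})+2TB$; 3. $\mathcal R(\mathsf{Server})\le\tilde{\mathcal O}(n\cdot n^{w_3})+\mathcal R(\Phi_n(\vec x))$ for every $\vec x\in[-N,N]^n$, and $\mathcal R(\mathsf{Server})\le\tilde{\mathcal O}(k\,n^{w_3})+\mathcal R(\Phi_n(\vec x))$ if $\vec x$ has at most $k$ non-zero entries. -/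

import Mathlib

open scoped BigOperators ENNReal

/-! ### Programs with a step count (logarithmic cost, in bit operations) -/

/-- The outcome of running a program: the value it returns and the number of bit operations it
performed. -/
structure Timed (α : Type) where
  val : α
  time : ℕ

namespace Timed

/-- Sequential composition adds up the running times. -/
instance : Monad Timed where
  pure a := ⟨a, 0⟩
  bind x f := ⟨(f x.val).val, x.time + (f x.val).time⟩

/-- Spend `c` bit operations. -/
def tick (c : ℕ) : Timed Unit := ⟨(), c⟩

/-- Run `body` for every element of the list, threading an accumulator; every round costs `c` on
top of the body. -/
def loopAux {ι α : Type} (c : ℕ) (body : α → ι → Timed α) : List ι → α → Timed α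
  | [], a => pure a
  | i :: l, a => do
      tick c
      let a' ← body a i
      loopAux c body l a'

/-- A `for` loop. Every round is charged the bit length of the number of rounds, which pays for the
loop counter and for addressing. -/
def forLoop {ι α : Type} (l : List ι) (a : α) (body : α → ι → Timed α) : Timed α :=
  loopAux (Nat.size l.length) body l a

/-- Two nested loops that fill the array `M` with `M i j = f i j`, with the same charge per round
as `forLoop`. -/
def tabulate {a b : ℕ} {R : Type} (f : Fin a → Fin b → Timed R) :
    Timed (Matrix (Fin a) (Fin b) R) :=
  ⟨Matrix.of fun i j => (f i j).val,
    ∑ i, (Nat.size a + ∑ j, (Nat.size b + (f i j).time))⟩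

end Timed

/-! ### Bit strings -/

/-- The residue `a` modulo `q`, written with `⌈log₂ q⌉` bits. -/
def bitsMod {q : ℕ} (a : ZMod q) : List Bool :=
  (List.range (Nat.clog 2 q)).map fun t => a.val.testBit t

/-- The entries of a vector modulo `q`, one after the other. -/
def bitsVector {q m : ℕ} (v : Fin m → ZMod q) : List Bool :=
  (List.finRange m).flatMap fun j => bitsMod (v j)

/-- The entries of a matrix modulo `q`, row by row. -/
def bitsMatrix {q a b : ℕ} (M : Matrix (Fin a) (Fin b) (ZMod q)) : List Bool :=
  (List.finRange a).flatMap fun i => bitsVector (M i)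

/-- A self-delimiting binary code for the integers. -/
def bitsInt (z : ℤ) : List Bool :=
  (z.natAbs.bits.flatMap fun b => [true, b]) ++ [false, decide (z < 0)]

/-- Code of a measurement result in `(ℤ/p)^m`; for `p = 0` this is a vector of integers, otherwise
the representatives in `(-p/2, p/2]` are written down. -/
def bitsMeasurement {p m : ℕ} (y : Fin m → ZMod p) : List Bool :=
  (List.finRange m).flatMap fun j => bitsInt (y j).valMinAbs

/-! ### Learning with errors -/

/-- Parameters of LWE and of GSW: lattice dimension `g`, number of samples `h`, modulus `q` and
width `σ` of the discrete Gaussian noise. The number of samples is large enough for the gadget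
matrix to have `h` columns. -/
structure GSWParams where
  g : ℕ
  h : ℕ
  q : ℕ
  σ : ℝ
  two_le_q : 2 ≤ q
  σ_pos : 0 < σ
  gadget_fits : (g + 1) * Nat.clog 2 q ≤ h

instance GSWParams.neZero (P : GSWParams) : NeZero P.q :=
  ⟨by have := P.two_le_q; omega⟩

/-- A Boolean circuit over the NAND basis: the list of its gates. The wires are numbered, first the
inputs, then the gates in their order; a gate is given by the two wires that it reads. The size of
the circuit is the length of the list. -/
abbrev NandCircuit := List (ℕ × ℕ)

/-- The value on the last wire. -/
def NandCircuit.output (D : NandCircuit) (input : List Bool) : Bool :=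
  (D.foldl (fun w p => w ++ [!(w.getD p.1 false && w.getD p.2 false)]) input).getLastD false

/-- The weight `ρ_σ(e) = exp (-π ‖e‖² / σ²)` of the discrete Gaussian on `ℤ^h`. -/
noncomputable def gaussianWeight {h : ℕ} (σ : ℝ) (e : Fin h → ℤ) : ℝ≥0∞ :=
  ENNReal.ofReal (Real.exp (-Real.pi * (∑ j, (e j : ℝ) ^ 2) / σ ^ 2))

/-- The value (`0` or `1`) of the distinguisher `D` on a pair `(A, v)`. -/
def lweVerdict (P : GSWParams) (D : NandCircuit) (A : Matrix (Fin P.g) (Fin P.h) (ZMod P.q))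
    (v : Fin P.h → ZMod P.q) : ℝ≥0∞ :=
  if D.output (bitsMatrix A ++ bitsVector v) = true then 1 else 0

/-- Probability that `D` outputs `1` on `(A, s A + e)`, with `A`, `s` uniform and `e` discrete
Gaussian. -/
noncomputable def lweRealProb (P : GSWParams) (D : NandCircuit) : ℝ≥0∞ :=
  (∑ A : Matrix (Fin P.g) (Fin P.h) (ZMod P.q), ∑ s : Fin P.g → ZMod P.q, ∑' e : Fin P.h → ℤ,
      gaussianWeight P.σ e *
        lweVerdict P D A (Matrix.vecMul s A + fun j => ((e j : ℤ) : ZMod P.q))) /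
    (∑ _A : Matrix (Fin P.g) (Fin P.h) (ZMod P.q), ∑ _s : Fin P.g → ZMod P.q,
      ∑' e : Fin P.h → ℤ, gaussianWeight P.σ e)

/-- Probability that `D` outputs `1` on `(A, v)`, with `A` and `v` uniform. -/
noncomputable def lweUniformProb (P : GSWParams) (D : NandCircuit) : ℝ≥0∞ :=
  (∑ A : Matrix (Fin P.g) (Fin P.h) (ZMod P.q), ∑ v : Fin P.h → ZMod P.q, lweVerdict P D A v) /
    (∑ _A : Matrix (Fin P.g) (Fin P.h) (ZMod P.q), ∑ _v : Fin P.h → ZMod P.q, 1)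

/-- The distinguishing advantage of `D` against LWE. -/
noncomputable def lweAdvantage (P : GSWParams) (D : NandCircuit) : ℝ :=
  |(lweRealProb P D).toReal - (lweUniformProb P D).toReal|

/-- Subexponential hardness of LWE for a family of parameters indexed by the security parameter
`κ`: adversaries of size `2^(κ^β)` have advantage at most `2^(-κ^c)`. -/
def SubexpLWEHard (P : ℕ → GSWParams) (β c : ℝ) : Prop :=
  ∃ κ₀ : ℕ, ∀ κ : ℕ, κ₀ < κ → ∀ D : NandCircuit,
    (D.length : ℝ) ≤ (2 : ℝ) ^ ((κ : ℝ) ^ β) →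
      lweAdvantage (P κ) D ≤ (2 : ℝ) ^ (-((κ : ℝ) ^ c))

/-- Polynomial hardness of LWE: non-uniform polynomial-size adversaries have negligible
advantage. -/
def PolyLWEHard (P : ℕ → GSWParams) : Prop :=
  ∀ D : ℕ → NandCircuit, (∃ d : ℕ, ∀ κ, (D κ).length ≤ κ ^ d + d) →
    ∀ e : ℝ, 0 < e → ∃ κ₀ : ℕ, ∀ κ : ℕ, κ₀ < κ →
      lweAdvantage (P κ) (D κ) < (κ : ℝ) ^ (-e)

/-! ### GSW evaluation -/

/-- Boolean circuits (formulas) with `l` inputs. -/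
inductive BoolFormula (l : ℕ) : Type
  | one : BoolFormula l
  | var : Fin l → BoolFormula l
  | not : BoolFormula l → BoolFormula l
  | and : BoolFormula l → BoolFormula l → BoolFormula l

/-- The Boolean function computed by a formula. -/
def BoolFormula.eval {l : ℕ} (μ : Fin l → Bool) : BoolFormula l → Bool
  | .one => true
  | .var j => μ j
  | .not F => !(F.eval μ)
  | .and F F' => F.eval μ && F'.eval μ

/-- The input `j`, or its negation, whichever is true on the binary representation of `i`. -/
def pointLiteral {l : ℕ} (i : ℕ) (j : Fin l) : BoolFormula l :=
  if i.testBit j then .var j else .not (.var j)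

/-- The circuit `C_i` of the point function: it outputs `1` exactly on the bit representation
of `i`. -/
def pointCircuit (l i : ℕ) : BoolFormula l :=
  (List.finRange l).foldl (fun F j => .and (pointLiteral i j) F) .one

theorem pointCircuit_eval (l i : ℕ) (μ : Fin l → Bool) :
    (pointCircuit l i).eval μ = true ↔ ∀ j : Fin l, μ j = i.testBit j := by
  have key : ∀ (L : List (Fin l)) (F : BoolFormula l),
      (L.foldl (fun F j => BoolFormula.and (pointLiteral i j) F) F).eval μ = true ↔
        (F.eval μ = true ∧ ∀ j ∈ L, μ j = i.testBit j) := by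
    intro L
    induction L with
    | nil => intro F; simp
    | cons a L ih =>
      intro F
      have h1 : (pointLiteral i a).eval μ = true ↔ μ a = i.testBit a := by
        unfold pointLiteral
        by_cases h : i.testBit a = true <;> simp [h, BoolFormula.eval]
      rw [List.foldl_cons, ih]
      simp only [BoolFormula.eval, Bool.and_eq_true, h1, List.mem_cons, forall_eq_or_imp]
      tauto
  rw [pointCircuit, key]
  simp [BoolFormula.eval]

namespace GSWParams

variable (P : GSWParams)

/-- Number of bits of a residue modulo `q`. -/
def bits : ℕ := Nat.clog 2 P.q

/-- Public keys, ciphertexts and linear combinations of ciphertexts are matrices of this shape. -/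
abbrev Ct : Type := Matrix (Fin (P.g + 1)) (Fin P.h) (ZMod P.q)

/-- The gadget matrix `G`: row `i` holds `1, 2, 4, …, 2^(⌈log₂ q⌉ - 1)` in the `i`-th block of
columns; the columns beyond the last block are zero. -/
def gadget : P.Ct :=
  Matrix.of fun i a => if (a : ℕ) / P.bits = i then 2 ^ ((a : ℕ) % P.bits) else 0

/-- The bit decomposition `G⁻¹(C)`, a matrix with entries in `{0, 1}` such that
`G * G⁻¹(C) = C`. -/
def gadgetInv (C : P.Ct) : Matrix (Fin P.h) (Fin P.h) (ZMod P.q) :=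
  Matrix.of fun a j =>
    if ha : (a : ℕ) / P.bits < P.g + 1 then
      if (C ⟨(a : ℕ) / P.bits, ha⟩ j).val.testBit ((a : ℕ) % P.bits) then 1 else 0
    else 0

/-- Homomorphic evaluation of GSW: `1 ↦ G`, `1 - μ ↦ G - C`, `μ μ' ↦ C * G⁻¹(C')`. It is
deterministic and makes no use of the public key. -/
def eval {l : ℕ} (ct : Fin l → P.Ct) : BoolFormula l → P.Ct
  | .one => P.gadget
  | .var j => ct j
  | .not F => P.gadget - eval ct F
  | .and F F' => eval ct F * P.gadgetInv (eval ct F')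

/-! Arithmetic modulo `q` on `b`-bit residues, by the schoolbook methods. -/

def copyMod (x : ZMod P.q) : Timed (ZMod P.q) := ⟨x, P.bits⟩

def addMod (x y : ZMod P.q) : Timed (ZMod P.q) := ⟨x + y, 2 * P.bits⟩

def subMod (x y : ZMod P.q) : Timed (ZMod P.q) := ⟨x - y, 2 * P.bits⟩

def mulMod (x y : ZMod P.q) : Timed (ZMod P.q) := ⟨x * y, 2 * P.bits ^ 2⟩

def eqMod (x y : ZMod P.q) : Timed Bool := ⟨decide (x = y), P.bits⟩

/-- Reduction of an integer modulo `q` by long division. -/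
def reduceMod (z : ℤ) : Timed (ZMod P.q) := ⟨(z : ZMod P.q), (Nat.size z.natAbs + 1) * P.bits⟩

/-- An entry of `G`: divide the column number by the block length, then write a power of two. -/
def gadgetEntry (i : Fin (P.g + 1)) (a : Fin P.h) : Timed (ZMod P.q) :=
  ⟨P.gadget i a, Nat.size P.h ^ 2 + P.bits⟩

/-- An entry of `G⁻¹(C)`: divide the row number by the block length, then read a bit of `C`. -/
def gadgetInvEntry (C : P.Ct) (a j : Fin P.h) : Timed (ZMod P.q) :=
  ⟨P.gadgetInv C a j, Nat.size P.h ^ 2 + P.bits⟩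

/-- Computes `G - C`. -/
def notProg (C : P.Ct) : Timed P.Ct :=
  Timed.tabulate fun i a => do
    let x ← P.gadgetEntry i a
    P.subMod x (C i a)

/-- Computes `C * G⁻¹(C')`. -/
def andProg (C C' : P.Ct) : Timed P.Ct := do
  let E ← Timed.tabulate fun a j => P.gadgetInvEntry C' a j
  Timed.tabulate fun i j =>
    Timed.forLoop (List.finRange P.h) 0 fun acc a => do
      let m ← P.mulMod (C i a) (E a j)
      P.addMod acc m

/-- Computes `S + c C`. -/
def scaleAddProg (S : P.Ct) (c : ZMod P.q) (C : P.Ct) : Timed P.Ct :=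
  Timed.tabulate fun i a => do
    let m ← P.mulMod c (C i a)
    P.addMod (S i a) m

/-- Computes `S + C`. -/
def addProg (S C : P.Ct) : Timed P.Ct :=
  Timed.tabulate fun i a => P.addMod (S i a) (C i a)

/-- A zero matrix. -/
def zeroProg : Timed P.Ct :=
  Timed.tabulate fun _ _ => P.copyMod 0

/-- Decides whether two matrices are equal. -/
def eqProg (S C : P.Ct) : Timed Bool :=
  Timed.forLoop (List.finRange (P.g + 1)) true fun acc i =>
    Timed.forLoop (List.finRange P.h) acc fun acc' a => do
      let e ← P.eqMod (S i a) (C i a)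
      pure (acc' && e)

/-- Evaluates the point circuit `C_i` homomorphically, gate by gate. -/
def pointEvalProg {l : ℕ} (ct : Fin l → P.Ct) (i : ℕ) : Timed P.Ct := do
  let G ← Timed.tabulate P.gadgetEntry
  Timed.forLoop (List.finRange l) G fun acc j => do
    Timed.tick (Nat.size i)
    let C ← Timed.tabulate fun a b => P.copyMod (ct j a b)
    let L ← if i.testBit j then pure C else P.notProg C
    P.andProg L acc

end GSWParams

/-! ### Relaxed sparse recovery by a deterministic linear measurement -/

/-- A deterministic algorithm for relaxed `k`-sparse recovery of vectors in `[-N, N]^n` that works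
through a linear measurement `Φ : ℤ^n → (ℤ/p)^m` (where `p = 0` stands for integer measurements):
a program computing `Φ`, and a program that recovers `x` from `Φ x` when `x` has at most `k`
non-zero entries, and returns an arbitrary vector in `[-N, N]^n` on any other input.
The vectors `Fin n →₀ ℤ` are held as lists of their non-zero entries. -/
structure RelaxedRecovery (n k N : ℕ) where
  p : ℕ
  m : ℕ
  Φ : (Fin n →₀ ℤ) →ₗ[ℤ] (Fin m → ZMod p)
  measure : (Fin n →₀ ℤ) → Timed (Fin m → ZMod p)
  measure_val : ∀ x, (measure x).val = Φ x
  report : (Fin m → ZMod p) → Timed (Fin n →₀ ℤ)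
  report_range : ∀ y i, |(report y).val i| ≤ N
  report_correct : ∀ x : Fin n →₀ ℤ, (∀ i, |x i| ≤ N) → x.support.card ≤ k →
    (report (Φ x)).val = x

/-- Number of bits of a measurement result. -/
def measurementSize {p m : ℕ} (y : Fin m → ZMod p) : ℕ := (bitsMeasurement y).length

/-- Adds two measurement results, entry by entry, in time linear in their lengths. -/
def addMeasurements {p m : ℕ} (y y' : Fin m → ZMod p) : Timed (Fin m → ZMod p) :=
  ⟨y + y', measurementSize y + measurementSize y'⟩

/-! ### The distributed protocol -/

namespace DistProt

variable {P : GSWParams} {n k N T : ℕ}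

/-- The state `ζ`: a (pseudo-)public key and `⌈log₂ n⌉` (pseudo-)ciphertexts. -/
abbrev State (P : GSWParams) (n : ℕ) : Type := P.Ct × (Fin (Nat.clog 2 n) → P.Ct)

/-- A packet: the sketch and the measurement of a data partition. -/
abbrev Packet (P : GSWParams) (A : RelaxedRecovery n k N) : Type :=
  P.Ct × (Fin A.m → ZMod A.p)

/-- Pseudo-public key and pseudo-ciphertexts are sampled independently and uniformly. -/
noncomputable def setup (P : GSWParams) (n : ℕ) : PMF (State P n) :=
  PMF.uniformOfFintype (State P n)

/-- The hash `∑ i, x i • ct̂_i`, where `ct̂_i` is the homomorphic evaluation of `C_i`. -/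
noncomputable def hash (ζ : State P n) (x : Fin n →₀ ℤ) : P.Ct :=
  ∑ i : Fin n, x i • P.eval ζ.2 (pointCircuit (Nat.clog 2 n) i)

/-- The packet sent by a server. -/
noncomputable def server (A : RelaxedRecovery n k N) (ζ : State P n) (x : Fin n →₀ ℤ) : Packet P A :=
  (hash ζ x, A.Φ x)

/-- The answer of the coordinator; `none` stands for `⊥`. -/
noncomputable def coordinator (A : RelaxedRecovery n k N) (ζ : State P n) (pkt : Fin T → Packet P A) :
    Option (Fin n →₀ ℤ) :=
  let x' := (A.report (∑ t, (pkt t).2)).val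
  if k < x'.support.card then none
  else if hash ζ x' = ∑ t, (pkt t).1 then some x' else none

/-- Bits exchanged between the coordinator and one server: the state `ζ` and the packet. -/
def communication (A : RelaxedRecovery n k N) (ζ : State P n) (pkt : Packet P A) : ℕ :=
  (bitsMatrix ζ.1).length + ((List.finRange _).flatMap fun j => bitsMatrix (ζ.2 j)).length +
    (bitsMatrix pkt.1).length + measurementSize pkt.2

/-- Computes the hash of `x`, with one homomorphic evaluation for each non-zero entry of `x`. -/
def hashProg (ζ : State P n) (x : Fin n →₀ ℤ) : Timed P.Ct := do
  let Z ← P.zeroProg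
  Timed.forLoop (x.support.sort (· ≤ ·)) Z fun acc i => do
    let C ← P.pointEvalProg ζ.2 i
    let c ← P.reduceMod (x i)
    P.scaleAddProg acc c C

/-- The program run by a server. -/
def serverProg (A : RelaxedRecovery n k N) (ζ : State P n) (x : Fin n →₀ ℤ) :
    Timed (Packet P A) := do
  let s ← hashProg ζ x
  let y ← A.measure x
  pure (s, y)

/-- Tests whether a vector has more than `k` non-zero entries, reading at most `k + 1` entries. -/
def denseProg (k : ℕ) (x : Fin n →₀ ℤ) : Timed Bool :=
  ⟨decide (k < x.support.card), (min x.support.card (k + 1) + 1) * Nat.size n⟩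

/-- The program run by the coordinator. The packets are added up in the order of their arrival,
without addressing, at one extra step per packet. -/
def coordinatorProg (A : RelaxedRecovery n k N) (ζ : State P n) (pkt : Fin T → Packet P A) :
    Timed (Option (Fin n →₀ ℤ)) := do
  let Z ← P.zeroProg
  let s ← Timed.loopAux 1 (fun acc t => P.addProg acc (pkt t).1) (List.finRange T) Z
  let y ← Timed.loopAux 1 (fun acc t => addMeasurements acc (pkt t).2) (List.finRange T) 0
  let x' ← A.report y
  let dense ← denseProg k x'
  if dense then pure none
  else do
    let H ← hashProg ζ x'
    let e ← P.eqProg H s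
    pure (if e then some x' else none)

end DistProt

/-! ### Instantiation and cost bounds -/

/-- The parameters `P κ` of GSW, as a function of the security parameter `κ`, instantiate the
protocol in which dimension `n` uses the security parameter `S n` and entries bounded by `N n`:
`g = κ`, `h = Θ(g log q)`, and `q > n N` is polynomially bounded in `n`. -/
structure GSWInstantiation (P : ℕ → GSWParams) (S N : ℕ → ℕ) : Prop where
  dim : ∀ κ, (P κ).g = κ
  samples : ∃ c₁ c₂ : ℝ, 0 < c₁ ∧ 0 < c₂ ∧ ∀ κ : ℕ, 1 ≤ κ →
    c₁ * (κ * Real.logb 2 (P κ).q) ≤ (P κ).h ∧ ((P κ).h : ℝ) ≤ c₂ * (κ * Real.logb 2 (P κ).q)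
  modulus_poly : ∃ a : ℕ, ∀ n, 2 ≤ n → (P (S n)).q ≤ n ^ a
  modulus_large : ∀ n, 2 ≤ n → n * N n < (P (S n)).q

/-- The costs of the protocol, up to factors `C (log n)^d`, with extra factors `F₁`, `F₂`, `F₃` in
the communication, the coordinator time and the server time. The programs are also asserted to
compute what the protocol prescribes. -/
def HasCosts (P : ℕ → GSWParams) (S N : ℕ → ℕ) (F₁ F₂ F₃ : ℕ → ℝ) : Prop :=
  ∃ (C : ℝ) (d : ℕ), ∀ n k : ℕ, 2 ≤ n → 1 ≤ k → k ≤ n →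
    ∀ A : RelaxedRecovery n k (N n), ∀ ζ ∈ (DistProt.setup (P (S n)) n).support,
      (∀ x : Fin n →₀ ℤ, (∀ i, |x i| ≤ N n) →
        (DistProt.serverProg A ζ x).val = DistProt.server A ζ x ∧
        (DistProt.communication A ζ (DistProt.server A ζ x) : ℝ) ≤
          C * Real.logb 2 n ^ d * F₁ n + measurementSize (A.Φ x) ∧
        ((DistProt.serverProg A ζ x).time : ℝ) ≤
          C * Real.logb 2 n ^ d * (n * F₃ n) + (A.measure x).time ∧
        (x.support.card ≤ k → ((DistProt.serverProg A ζ x).time : ℝ) ≤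
          C * Real.logb 2 n ^ d * (k * F₃ n) + (A.measure x).time)) ∧
      (∀ (T : ℕ) (x : Fin T → (Fin n →₀ ℤ)),
        (∀ (U : Finset (Fin T)) (i : Fin n), |∑ t ∈ U, x t i| ≤ N n) →
        ∀ B : ℕ, (∀ z : Fin n →₀ ℤ, (∀ i, |z i| ≤ N n) → measurementSize (A.Φ z) ≤ B) →
          (DistProt.coordinatorProg A ζ fun t => DistProt.server A ζ (x t)).val =
            DistProt.coordinator A ζ (fun t => DistProt.server A ζ (x t)) ∧
          ((DistProt.coordinatorProg A ζ fun t => DistProt.server A ζ (x t)).time : ℝ) ≤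
            C * Real.logb 2 n ^ d * (k * F₂ n) + (A.report (A.Φ (∑ t, x t))).time +
              (C * Real.logb 2 n ^ d * (T * F₂ n) + 2 * T * B))

/-! Apart from the recovery algorithm, the programs handle indices below `n`, entries bounded by `N
< q`, and matrices whose dimensions are at most `g + 1` and `h` and whose entries have `⌈log q⌉`
bits. Since `h = Θ(g log q)` and `q` is polynomial in `n`, a single number `M = O(S(n) log n)`
bounds all these dimensions and bit lengths (`GSWInstantiation.exists_sizeBound`). A matrix
operation then costs a fixed power of `M`, and so does the evaluation of a point circuit, which has
only `⌈log n⌉` AND gates (`pointEvalProg_time`).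

Hashing repeats this evaluation once per non-zero coordinate (`hashProg_time`). The coordinator
hashes only after the sparsity test, hence at most `k` coordinates. By linearity of `Φ`, its running
sums of measurements are measurements of subset sums of the data, so they have at most `B` bits
(`sum_measurements_time`).

Up to the costs of `Φ` and `Report`, everything is thus at most `M ^ 18` times `1`, `k`, `n` or `T`.
The factor `S(n) ^ 18` is polylogarithmic for `S(n) = ⌈log^r n⌉`, and is `O(n ^ wᵢ)` for `S(n) = ⌈n
^ w⌉` as soon as `18 w ≤ wᵢ`. The exponents are not optimised: a numerical constant is usually
absorbed by one more factor `M ≥ 4`. -/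

/-! ### Values and running times of loops -/

namespace Timed

@[simp] theorem pure_val {α : Type} (a : α) : (pure a : Timed α).val = a := rfl

@[simp] theorem pure_time {α : Type} (a : α) : (pure a : Timed α).time = 0 := rfl

@[simp] theorem bind_val {α β : Type} (x : Timed α) (f : α → Timed β) :
    (x >>= f).val = (f x.val).val := rfl

@[simp] theorem bind_time {α β : Type} (x : Timed α) (f : α → Timed β) :
    (x >>= f).time = x.time + (f x.val).time := rfl

@[simp] theorem tick_time (c : ℕ) : (tick c).time = c := rfl

@[simp] theorem tabulate_val {a b : ℕ} {R : Type} (f : Fin a → Fin b → Timed R) :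
    (tabulate f).val = Matrix.of fun i j => (f i j).val := rfl

theorem loopAux_val {ι α : Type} (c : ℕ) (body : α → ι → Timed α) (l : List ι) (a : α) :
    (loopAux c body l a).val = l.foldl (fun a i => (body a i).val) a := by
  induction l generalizing a with
  | nil => rfl
  | cons i l ih => simp [loopAux, ih]

theorem loopAux_time_le {ι α : Type} (c b : ℕ) (body : α → ι → Timed α) (l : List ι) (a : α)
    (h : ∀ a, ∀ i ∈ l, (body a i).time ≤ b) :
    (loopAux c body l a).time ≤ l.length * (c + b) := by
  induction l generalizing a with
  | nil => simp [loopAux]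
  | cons i l ih =>
    have h1 := h a i (by simp)
    have h2 := ih (body a i).val fun a j hj => h a j (by simp [hj])
    simp only [loopAux, bind_time, tick_time, List.length_cons, Nat.succ_mul]
    omega

theorem forLoop_val {ι α : Type} (body : α → ι → Timed α) (l : List ι) (a : α) :
    (forLoop l a body).val = l.foldl (fun a i => (body a i).val) a :=
  loopAux_val _ _ _ _

/-- The number of rounds stays as a separate factor, because it may be as large as `n`; only its bit
length, the charge per round, is at most `M`. -/
theorem forLoop_time_le {ι α : Type} {M e : ℕ} (hM : 2 ≤ M) (he : 1 ≤ e)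
    (body : α → ι → Timed α) (l : List ι) (a : α) (hl : Nat.size l.length ≤ M)
    (h : ∀ a, ∀ i ∈ l, (body a i).time ≤ M ^ e) :
    (forLoop l a body).time ≤ l.length * M ^ (e + 1) := by
  refine (loopAux_time_le _ (M ^ e) _ _ _ h).trans (Nat.mul_le_mul_left _ ?_)
  have h1 : M ^ 1 ≤ M ^ e := Nat.pow_le_pow_right (by omega) he
  have h2 : 2 * M ^ e ≤ M ^ (e + 1) := by
    rw [pow_succ, mul_comm]; exact Nat.mul_le_mul_left _ hM
  simp only [pow_one] at h1
  omega

/-- At most `M ^ 2` entries are filled; the third extra power of `M` absorbs the addressing. -/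
theorem tabulate_time_le {a b : ℕ} {R : Type} {M e : ℕ} (hM : 3 ≤ M) (he : 1 ≤ e)
    (ha : a ≤ M) (hb : b ≤ M) (f : Fin a → Fin b → Timed R)
    (h : ∀ i j, (f i j).time ≤ M ^ e) : (tabulate f).time ≤ M ^ (e + 3) := by
  have size_le : ∀ x : ℕ, x ≤ M → Nat.size x ≤ M := fun x hx =>
    (Nat.size_le.2 Nat.lt_two_pow_self).trans hx
  have h1 : M ^ 1 ≤ M ^ e := Nat.pow_le_pow_right (by omega) he
  have inner : ∀ i, (∑ j, (Nat.size b + (f i j).time)) ≤ M * (M + M ^ e) := by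
    intro i
    refine (Finset.sum_le_card_nsmul _ _ (M + M ^ e) fun j _ => ?_).trans ?_
    · exact add_le_add (size_le b hb) (h i j)
    · simpa using Nat.mul_le_mul_right _ hb
  have outer : (tabulate f).time ≤ M * (M + M * (M + M ^ e)) := by
    change ∑ i, (Nat.size a + ∑ j, (Nat.size b + (f i j).time)) ≤ _
    refine (Finset.sum_le_card_nsmul _ _ (M + M * (M + M ^ e)) fun i _ => ?_).trans ?_
    · exact add_le_add (size_le a ha) (inner i)
    · simpa using Nat.mul_le_mul_right _ ha
  refine outer.trans ?_
  rw [pow_one] at h1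
  calc M * (M + M * (M + M ^ e)) ≤ M * (M * M ^ e + M * (M ^ e + M ^ e)) := by
        gcongr
        exact Nat.le_mul_of_pos_right _ (by omega)
    _ = M ^ (e + 2) * 3 := by ring
    _ ≤ M ^ (e + 2) * M := by gcongr
    _ = M ^ (e + 3) := by ring

end Timed

/-! ### Correctness of the GSW programs -/

namespace GSWParams

variable (P : GSWParams)

theorem foldl_add_eq_add_sum {ι R : Type} [AddCommMonoid R] (f : ι → R) (l : List ι) (a : R) :
    l.foldl (fun acc i => acc + f i) a = a + (l.map f).sum := by
  induction l generalizing a with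
  | nil => simp
  | cons i l ih => simp [ih, add_assoc]

theorem notProg_val (C : P.Ct) : (P.notProg C).val = P.gadget - C := rfl

theorem andProg_val (C C' : P.Ct) : (P.andProg C C').val = C * P.gadgetInv C' := by
  ext i j
  simp [andProg, Timed.forLoop_val, mulMod, addMod, gadgetInvEntry, Matrix.mul_apply,
    foldl_add_eq_add_sum, List.sum_ofFn, ← List.ofFn_eq_map]

theorem scaleAddProg_val (S : P.Ct) (c : ZMod P.q) (C : P.Ct) :
    (P.scaleAddProg S c C).val = S + c • C := rfl

theorem addProg_val (S C : P.Ct) : (P.addProg S C).val = S + C := rfl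

theorem zeroProg_val : P.zeroProg.val = 0 := rfl

theorem foldl_and_eq_all {ι : Type} (f : ι → Bool) (l : List ι) (a : Bool) :
    l.foldl (fun acc i => acc && f i) a = (a && l.all f) := by
  induction l generalizing a with
  | nil => simp
  | cons i l ih => simp [ih, Bool.and_assoc]

theorem eqProg_val (S C : P.Ct) : (P.eqProg S C).val = decide (S = C) := by
  simp only [eqProg, Timed.forLoop_val, Timed.bind_val, Timed.pure_val, eqMod, foldl_and_eq_all]
  rw [Bool.eq_iff_iff]
  simp [← Matrix.ext_iff]

theorem pointEvalProg_val {l : ℕ} (ct : Fin l → P.Ct) (i : ℕ) :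
    (P.pointEvalProg ct i).val = P.eval ct (pointCircuit l i) := by
  -- Loop invariant: the accumulator is the evaluation of the formula built so far. The start `F` is
  -- arbitrary so that the induction can move it.
  have key : ∀ (L : List (Fin l)) (F : BoolFormula l) (body : P.Ct → Fin l → P.Ct),
      (∀ acc j, body acc j = P.eval ct (pointLiteral i j) * P.gadgetInv acc) →
      L.foldl body (P.eval ct F) =
        P.eval ct (L.foldl (fun F j => BoolFormula.and (pointLiteral i j) F) F) := by
    intro L F body hbody
    induction L generalizing F with
    | nil => rfl
    | cons j L ih => rw [List.foldl_cons, List.foldl_cons, ← ih, hbody]; rfl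
  simp only [pointEvalProg, Timed.bind_val, Timed.forLoop_val]
  refine key _ .one _ fun acc j => ?_
  unfold pointLiteral
  split_ifs
  · rw [Timed.bind_val, andProg_val]; rfl
  · rw [Timed.bind_val, andProg_val, notProg_val]; rfl

/-! ### Running times of the GSW programs -/

/-- `M` bounds the dimensions of the ciphertexts and the bit length of the modulus. -/
structure SizeBound (M : ℕ) : Prop where
  four_le : 4 ≤ M
  dim_le : P.g + 1 ≤ M
  samples_le : P.h ≤ M
  bits_le : P.bits ≤ M

variable {P} {M : ℕ}

theorem size_le_of_le {x : ℕ} (hx : x ≤ M) : Nat.size x ≤ M :=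
  (Nat.size_le.2 Nat.lt_two_pow_self).trans hx

/-- Absorbs a sum of up to four powers into the next power. -/
theorem add_pow_le (hM : 4 ≤ M) {e a b c d : ℕ} (ha : a ≤ M ^ e) (hb : b ≤ M ^ e) (hc : c ≤ M ^ e)
    (hd : d ≤ M ^ e) : a + b + c + d ≤ M ^ (e + 1) := by
  have : M ^ e * 4 ≤ M ^ (e + 1) := by rw [pow_succ]; gcongr
  omega

namespace SizeBound

theorem pow_le (h : P.SizeBound M) {a e f : ℕ} (ha : a ≤ M ^ e) (hef : e ≤ f) : a ≤ M ^ f :=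
  ha.trans (Nat.pow_le_pow_right (by have := h.four_le; omega) hef)

theorem add_le (h : P.SizeBound M) {e a b : ℕ} (ha : a ≤ M ^ e) (hb : b ≤ M ^ e) :
    a + b ≤ M ^ (e + 1) := by
  simpa using add_pow_le h.four_le ha hb (Nat.zero_le _) (Nat.zero_le _)

theorem tabulate_le (h : P.SizeBound M) {a b e : ℕ} {R : Type} (ha : a ≤ M) (hb : b ≤ M)
    (f : Fin a → Fin b → Timed R) (he : 1 ≤ e) (hf : ∀ i j, (f i j).time ≤ M ^ e) :
    (Timed.tabulate f).time ≤ M ^ (e + 3) :=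
  Timed.tabulate_time_le (by have := h.four_le; omega) he ha hb f hf

theorem forLoop_le (h : P.SizeBound M) {ι α : Type} {e : ℕ} (body : α → ι → Timed α)
    (l : List ι) (a : α) (hl : l.length ≤ M) (he : 1 ≤ e)
    (hb : ∀ a, ∀ i ∈ l, (body a i).time ≤ M ^ e) :
    (Timed.forLoop l a body).time ≤ M ^ (e + 2) := by
  refine (Timed.forLoop_time_le (by have := h.four_le; omega) he body l a
    (size_le_of_le hl) hb).trans ?_
  calc l.length * M ^ (e + 1) ≤ M * M ^ (e + 1) := by gcongr
    _ = M ^ (e + 2) := by ring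

theorem copyMod_time (h : P.SizeBound M) (x : ZMod P.q) : (P.copyMod x).time ≤ M ^ 1 := by
  simpa [copyMod] using h.bits_le

theorem addMod_time (h : P.SizeBound M) (x y : ZMod P.q) : (P.addMod x y).time ≤ M ^ 2 := by
  have := h.bits_le; have := h.four_le
  simp only [addMod]; nlinarith

theorem subMod_time (h : P.SizeBound M) (x y : ZMod P.q) : (P.subMod x y).time ≤ M ^ 2 :=
  h.addMod_time x y

theorem mulMod_time (h : P.SizeBound M) (x y : ZMod P.q) : (P.mulMod x y).time ≤ M ^ 3 := by
  have h1 := h.bits_le; have h2 := h.four_le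
  calc 2 * P.bits ^ 2 ≤ M * M ^ 2 := by gcongr; omega
    _ = M ^ 3 := by ring

theorem eqMod_time (h : P.SizeBound M) (x y : ZMod P.q) : (P.eqMod x y).time ≤ M ^ 1 := by
  simpa [eqMod] using h.bits_le

theorem reduceMod_time (h : P.SizeBound M) (z : ℤ) (hz : z.natAbs ≤ P.q) :
    (P.reduceMod z).time ≤ M ^ 3 := by
  have h1 := h.bits_le; have h2 := h.four_le
  -- One bit more than `bits`, since `q`, and hence `|z|`, may equal `2 ^ bits`.
  have hs : Nat.size z.natAbs ≤ M + 1 := by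
    refine Nat.size_le.2 ?_
    calc z.natAbs ≤ P.q := hz
      _ ≤ 2 ^ P.bits := Nat.le_pow_clog (by norm_num) _
      _ < 2 ^ (M + 1) := Nat.pow_lt_pow_right (by norm_num) (by omega)
  calc (Nat.size z.natAbs + 1) * P.bits ≤ (M + 1 + 1) * M := by gcongr
    _ ≤ M ^ 2 * M := by gcongr; nlinarith
    _ = M ^ 3 := by ring

theorem gadgetEntry_time (h : P.SizeBound M) (i : Fin (P.g + 1)) (a : Fin P.h) :
    (P.gadgetEntry i a).time ≤ M ^ 3 := by
  have h1 := size_le_of_le h.samples_le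
  exact h.add_le (Nat.pow_le_pow_left h1 2) (h.pow_le (e := 1) (by simpa using h.bits_le) (by omega))

theorem gadgetInvEntry_time (h : P.SizeBound M) (C : P.Ct) (a j : Fin P.h) :
    (P.gadgetInvEntry C a j).time ≤ M ^ 3 := by
  have h1 := size_le_of_le h.samples_le
  exact h.add_le (Nat.pow_le_pow_left h1 2) (h.pow_le (e := 1) (by simpa using h.bits_le) (by omega))

theorem notProg_time (h : P.SizeBound M) (C : P.Ct) : (P.notProg C).time ≤ M ^ 7 :=
  h.tabulate_le (e := 4) h.dim_le h.samples_le _ (by omega) fun i a =>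
    h.add_le (h.gadgetEntry_time i a) (h.pow_le (h.subMod_time _ _) (by omega))

theorem andProg_time (h : P.SizeBound M) (C C' : P.Ct) : (P.andProg C C').time ≤ M ^ 10 := by
  refine h.add_le (e := 9) ?_ ?_
  · exact h.pow_le (h.tabulate_le h.samples_le h.samples_le _ (by omega)
      fun a j => h.gadgetInvEntry_time C' a j) (by omega)
  · exact h.tabulate_le (e := 6) h.dim_le h.samples_le _ (by omega) fun i j =>
      h.forLoop_le (e := 4) _ _ _ (by simpa using h.samples_le) (by omega) fun acc a _ =>
        h.add_le (h.mulMod_time _ _) (h.pow_le (h.addMod_time _ _) (by omega))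

theorem scaleAddProg_time (h : P.SizeBound M) (S : P.Ct) (c : ZMod P.q) (C : P.Ct) :
    (P.scaleAddProg S c C).time ≤ M ^ 7 :=
  h.tabulate_le (e := 4) h.dim_le h.samples_le _ (by omega) fun _ _ =>
    h.add_le (h.mulMod_time _ _) (h.pow_le (h.addMod_time _ _) (by omega))

theorem addProg_time (h : P.SizeBound M) (S C : P.Ct) : (P.addProg S C).time ≤ M ^ 5 :=
  h.tabulate_le h.dim_le h.samples_le _ (by omega) fun _ _ => h.addMod_time _ _

theorem zeroProg_time (h : P.SizeBound M) : P.zeroProg.time ≤ M ^ 4 :=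
  h.tabulate_le h.dim_le h.samples_le _ (by omega) fun _ _ => h.copyMod_time _

theorem eqProg_time (h : P.SizeBound M) (S C : P.Ct) : (P.eqProg S C).time ≤ M ^ 5 :=
  h.forLoop_le (e := 3) _ _ _ (by simpa using h.dim_le) (by omega) fun _ i _ =>
    h.forLoop_le (e := 1) _ _ _ (by simpa using h.samples_le) le_rfl fun _ a _ =>
      h.eqMod_time (S i a) (C i a)

theorem pointEvalProg_time (h : P.SizeBound M) {l : ℕ} (ct : Fin l → P.Ct) (i : ℕ) (hl : l ≤ M)
    (hi : Nat.size i ≤ M) : (P.pointEvalProg ct i).time ≤ M ^ 14 := by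
  refine h.add_le (e := 13) ?_ ?_
  · exact h.pow_le (h.tabulate_le h.dim_le h.samples_le _ (by omega) h.gadgetEntry_time)
      (by omega)
  · refine h.forLoop_le (e := 11) _ _ _ (by simpa using hl) (by omega) fun acc j _ => ?_
    have h1 : Nat.size i ≤ M ^ 10 := h.pow_le (e := 1) (by simpa using hi) (by omega)
    have h2 : (Timed.tabulate fun a b => P.copyMod (ct j a b)).time ≤ M ^ 10 :=
      h.pow_le (h.tabulate_le h.dim_le h.samples_le _ le_rfl fun _ _ => h.copyMod_time _)
        (by omega)
    simp only [Timed.bind_time, Timed.tick_time]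
    split_ifs <;> simp only [Timed.bind_time, Timed.pure_time, ← add_assoc]
    · exact add_pow_le h.four_le h1 h2 (Nat.zero_le _) (h.andProg_time _ _)
    · exact add_pow_le h.four_le h1 h2 (h.pow_le (h.notProg_time _) (by omega))
        (h.andProg_time _ _)

end SizeBound

theorem length_bitsVector {q m : ℕ} (v : Fin m → ZMod q) :
    (bitsVector v).length = m * Nat.clog 2 q := by
  simp [bitsVector, bitsMod, List.length_flatMap]

theorem length_bitsMatrix {q a b : ℕ} (A : Matrix (Fin a) (Fin b) (ZMod q)) :
    (bitsMatrix A).length = a * (b * Nat.clog 2 q) := by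
  simp [bitsMatrix, length_bitsVector, List.length_flatMap]

end GSWParams

/-! ### Correctness and costs of the protocol -/

namespace DistProt

variable {P : GSWParams} {n k N T M : ℕ}

/-- Coordinates outside the support contribute zero, and reducing `x i` modulo `q` does not change
its action on matrices over `ZMod q`. -/
theorem hashProg_val (ζ : State P n) (x : Fin n →₀ ℤ) : (hashProg ζ x).val = hash ζ x := by
  have h : ∀ i : Fin n, ((x i : ℤ) : ZMod P.q) • P.eval ζ.2 (pointCircuit (Nat.clog 2 n) i) =
      x i • P.eval ζ.2 (pointCircuit (Nat.clog 2 n) i) := fun i => Int.cast_smul_eq_zsmul _ _ _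
  simp only [hashProg, hash, Timed.bind_val, Timed.forLoop_val, GSWParams.pointEvalProg_val,
    GSWParams.scaleAddProg_val, GSWParams.zeroProg_val, GSWParams.reduceMod,
    GSWParams.foldl_add_eq_add_sum, h, zero_add]
  have hs : (x.support.sort (· ≤ ·)).toFinset = x.support := Finset.sort_toFinset _ _
  rw [← List.sum_toFinset _ (Finset.sort_nodup _ _), hs]
  refine Finset.sum_subset (Finset.subset_univ _) fun i _ hi => ?_
  rw [Finsupp.notMem_support_iff.1 hi, zero_smul]

theorem serverProg_val (A : RelaxedRecovery n k N) (ζ : State P n) (x : Fin n →₀ ℤ) :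
    (serverProg A ζ x).val = server A ζ x := by
  simp [serverProg, server, hashProg_val, A.measure_val]

theorem sum_packets_val (A : RelaxedRecovery n k N) (pkt : Fin T → Packet P A) :
    (Timed.loopAux 1 (fun acc t => P.addProg acc (pkt t).1) (List.finRange T)
      P.zeroProg.val).val = ∑ t, (pkt t).1 := by
  simp [Timed.loopAux_val, GSWParams.addProg_val, GSWParams.zeroProg_val,
    GSWParams.foldl_add_eq_add_sum, List.sum_ofFn, ← List.ofFn_eq_map]

theorem sum_measurements_val (A : RelaxedRecovery n k N) (pkt : Fin T → Packet P A) :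
    (Timed.loopAux 1 (fun acc t => addMeasurements acc (pkt t).2) (List.finRange T) 0).val =
      ∑ t, (pkt t).2 := by
  simp [Timed.loopAux_val, addMeasurements,
    GSWParams.foldl_add_eq_add_sum, List.sum_ofFn, ← List.ofFn_eq_map]

theorem coordinatorProg_val (A : RelaxedRecovery n k N) (ζ : State P n)
    (pkt : Fin T → Packet P A) : (coordinatorProg A ζ pkt).val = coordinator A ζ pkt := by
  simp only [coordinatorProg, coordinator, Timed.bind_val, sum_packets_val, sum_measurements_val,
    denseProg, decide_eq_true_eq]
  split_ifs with h1 h2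
  · rfl
  all_goals simp [GSWParams.eqProg_val, hashProg_val, h2]

theorem hashProg_time (h : P.SizeBound M) (hn : Nat.size n ≤ M) (hN : N ≤ P.q)
    (ζ : State P n) (x : Fin n →₀ ℤ) (hx : ∀ i, |x i| ≤ N) :
    (hashProg ζ x).time ≤ M ^ 4 + x.support.card * M ^ 16 := by
  have hM := h.four_le
  refine Nat.add_le_add h.zeroProg_time ?_
  have hcard : x.support.card ≤ n := by simpa using x.support.card_le_univ
  have := Timed.forLoop_time_le (M := M) (e := 15) (by omega) (by omega)
    (fun acc (i : Fin n) => do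
      let C ← P.pointEvalProg ζ.2 i
      let c ← P.reduceMod (x i)
      P.scaleAddProg acc c C) (x.support.sort (· ≤ ·)) P.zeroProg.val
      (by rw [Finset.length_sort]; exact (Nat.size_le_size hcard).trans hn) ?_
  · rwa [Finset.length_sort] at this
  · intro acc i _
    have hl : Nat.clog 2 n ≤ M :=
      (Nat.clog_le_of_le_pow (Nat.size_le.1 le_rfl).le).trans hn
    have h1 := h.pointEvalProg_time ζ.2 i hl ((Nat.size_le_size i.2.le).trans hn)
    have h2 := h.reduceMod_time (x i) (by have := abs_le.1 (hx i); omega)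
    have h3 := h.scaleAddProg_time acc (P.reduceMod (x i)).val (P.pointEvalProg ζ.2 i).val
    have h4 := GSWParams.add_pow_le (e := 14) hM h1 (h.pow_le h2 (by omega))
      (h.pow_le h3 (by omega)) (Nat.zero_le _)
    simp only [Timed.bind_time]
    change _ ≤ M ^ (14 + 1)
    omega

/-- The parameter `s` serves both bounds, with `s = n` and `s = k`; `1 ≤ s` pays for the zero matrix
when `x = 0`. -/
theorem serverProg_time (h : P.SizeBound M) (hn : Nat.size n ≤ M) (hN : N ≤ P.q)
    (A : RelaxedRecovery n k N) (ζ : State P n) (x : Fin n →₀ ℤ) (hx : ∀ i, |x i| ≤ N) {s : ℕ}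
    (hs : 1 ≤ s) (hxs : x.support.card ≤ s) :
    (serverProg A ζ x).time ≤ s * M ^ 17 + (A.measure x).time := by
  have hM := h.four_le
  have h1 := hashProg_time h hn hN ζ x hx
  have h2 : M ^ 4 + x.support.card * M ^ 16 ≤ s * M ^ 17 := by
    calc M ^ 4 + x.support.card * M ^ 16 ≤ s * M ^ 16 + s * M ^ 16 := by
          gcongr
          exact (Nat.pow_le_pow_right (by omega) (by omega)).trans (Nat.le_mul_of_pos_left _ hs)
      _ = s * (M ^ 16 * 2) := by ring
      _ ≤ s * (M ^ 16 * M) := by gcongr; omega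
      _ = s * M ^ 17 := by ring
  simp only [serverProg, Timed.bind_time, Timed.pure_time]
  omega

theorem communication_le (h : P.SizeBound M) (hn : Nat.size n ≤ M)
    (A : RelaxedRecovery n k N) (ζ : State P n) (pkt : Packet P A) :
    communication A ζ pkt ≤ M ^ 5 + measurementSize pkt.2 := by
  have hl : Nat.clog 2 n ≤ M := (Nat.clog_le_of_le_pow (Nat.size_le.1 le_rfl).le).trans hn
  have hM := h.four_le
  have hc : (P.g + 1) * (P.h * Nat.clog 2 P.q) ≤ M * (M * M) :=
    Nat.mul_le_mul h.dim_le (Nat.mul_le_mul h.samples_le h.bits_le)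
  simp only [communication, GSWParams.length_bitsMatrix, List.length_flatMap, List.map_const',
    List.length_finRange, List.sum_replicate, smul_eq_mul]
  refine Nat.add_le_add_right ?_ _
  -- The matrices sent are the public key, `⌈log n⌉` ciphertexts and the sketch.
  calc _ = (Nat.clog 2 n + 2) * ((P.g + 1) * (P.h * Nat.clog 2 P.q)) := by ring
    _ ≤ (M + 2) * (M * (M * M)) := by gcongr
    _ ≤ (M * M) * (M * (M * M)) := by gcongr; nlinarith
    _ = M ^ 5 := by ring

/-- The partial sums of the measurements are measurements of partial sums of the data, so that
adding up the packets never meets a measurement longer than `B`. -/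
theorem sum_measurements_time (A : RelaxedRecovery n k N) (ζ : State P n)
    (x : Fin T → (Fin n →₀ ℤ)) (hx : ∀ (U : Finset (Fin T)) (i : Fin n), |∑ t ∈ U, x t i| ≤ N)
    {B : ℕ} (hB : ∀ z : Fin n →₀ ℤ, (∀ i, |z i| ≤ N) → measurementSize (A.Φ z) ≤ B) :
    (Timed.loopAux 1 (fun acc t => addMeasurements acc (server A ζ (x t)).2)
      (List.finRange T) 0).time ≤ T * (1 + 2 * B) := by
  have hU : ∀ U : Finset (Fin T), measurementSize (A.Φ (∑ t ∈ U, x t)) ≤ B := fun U =>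
    hB _ fun i => by simpa [Finsupp.finsetSum_apply] using hx U i
  -- `U` is the set of packets already added, `l` the list of those to come; disjointness makes each
  -- new sum the measurement of a sum over `insert t U`.
  have key : ∀ (l : List (Fin T)) (U : Finset (Fin T)), l.Nodup → (∀ t ∈ l, t ∉ U) →
      (Timed.loopAux 1 (fun acc t => addMeasurements acc (server A ζ (x t)).2)
        l (A.Φ (∑ t ∈ U, x t))).time ≤ l.length * (1 + 2 * B) := by
    intro l
    induction l with
    | nil => intro U _ _; simp [Timed.loopAux]
    | cons t l ih =>
      intro U hl hd
      rw [List.nodup_cons] at hl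
      have ht : t ∉ U := hd t (by simp)
      have h1 := ih (insert t U) hl.2 fun s hs => by
        rw [Finset.mem_insert, not_or]
        exact ⟨fun e => hl.1 (e ▸ hs), hd s (by simp [hs])⟩
      rw [Finset.sum_insert ht, map_add, add_comm] at h1
      have h2 := hU U
      have h3 := hU {t}
      rw [Finset.sum_singleton] at h3
      simp only [Timed.loopAux, Timed.bind_time, Timed.tick_time, List.length_cons, add_mul,
        one_mul]
      simp only [addMeasurements, server] at h1 ⊢
      omega
  simpa using key (List.finRange T) ∅ (List.nodup_finRange T) (by simp)

/-- By linearity `Report` runs on `Φ (∑ t, x t)`. This sum need not be sparse, but `report_range`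
still keeps the entries of the answer within `N`, so reducing them modulo `q` is cheap. -/
theorem coordinatorProg_time (h : P.SizeBound M) (hn : Nat.size n ≤ M) (hN : N ≤ P.q)
    (hk : 1 ≤ k) (A : RelaxedRecovery n k N) (ζ : State P n) (x : Fin T → (Fin n →₀ ℤ))
    (hx : ∀ (U : Finset (Fin T)) (i : Fin n), |∑ t ∈ U, x t i| ≤ N)
    {B : ℕ} (hB : ∀ z : Fin n →₀ ℤ, (∀ i, |z i| ≤ N) → measurementSize (A.Φ z) ≤ B) :
    (coordinatorProg A ζ fun t => server A ζ (x t)).time ≤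
      k * M ^ 18 + (A.report (A.Φ (∑ t, x t))).time + (T * M ^ 6 + 2 * T * B) := by
  have hM := h.four_le
  have hsum := Timed.loopAux_time_le 1 (M ^ 5)
    (fun acc t => P.addProg acc (server A ζ (x t)).1) (List.finRange T) P.zeroProg.val
    fun acc t _ => h.addProg_time _ _
  rw [List.length_finRange] at hsum
  have hmeas := sum_measurements_time A ζ x hx hB
  have hval : (∑ t, (server A ζ (x t)).2) = A.Φ (∑ t, x t) := by simp [server, map_sum]
  have hT : T * (1 + M ^ 5) + T * (1 + 2 * B) ≤ T * M ^ 6 + 2 * T * B := by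
    have h1 : M ^ 5 * 4 ≤ M ^ 6 := by rw [pow_succ M 5]; gcongr
    have h2 : 1 ≤ M ^ 5 := Nat.one_le_pow _ _ (by omega)
    calc T * (1 + M ^ 5) + T * (1 + 2 * B) = T * (2 + M ^ 5) + 2 * T * B := by ring
      _ ≤ T * M ^ 6 + 2 * T * B := by gcongr; omega
  set y := A.Φ (∑ t, x t) with hy
  set x' := (A.report y).val with hx'
  have hz := h.zeroProg_time
  have hpow : ∀ {a e : ℕ}, a ≤ M ^ e → e ≤ 17 → a ≤ k * M ^ 17 := fun ha he =>
    (h.pow_le ha he).trans (Nat.le_mul_of_pos_left _ hk)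
  -- The test stops after `k + 1` entries, so a dense answer costs no more; `k + 2 ≤ 3 k` uses `1 ≤
  -- k`.
  have hdense : (denseProg k x').time ≤ k * M ^ 17 := by
    calc (min x'.support.card (k + 1) + 1) * Nat.size n ≤ (k + 1 + 1) * M := by
          gcongr; exact min_le_right _ _
      _ ≤ (k * 3) * M := by gcongr; omega
      _ ≤ (k * M) * M := by gcongr; omega
      _ = k * M ^ 2 := by ring
      _ ≤ k * M ^ 17 := by gcongr <;> omega
  -- Here `a` is the cost after the sparsity test: `0` if the answer is dense, hashing and
  -- comparison otherwise.
  have htotal : ∀ a : ℕ, a ≤ M ^ 4 + k * M ^ 16 + M ^ 5 →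
      P.zeroProg.time + (denseProg k x').time + a ≤ k * M ^ 18 := by
    intro a ha
    have h1 : k * M ^ 17 * 4 ≤ k * M ^ 18 := by rw [pow_succ M 17, ← mul_assoc]; gcongr
    have h2 : k * M ^ 16 * 4 ≤ k * M ^ 17 := by rw [pow_succ M 16, ← mul_assoc]; gcongr
    have h3 : M ^ 4 ≤ k * M ^ 16 :=
      (Nat.pow_le_pow_right (by omega) (by omega)).trans (Nat.le_mul_of_pos_left _ hk)
    have h4 : M ^ 5 ≤ k * M ^ 16 :=
      (Nat.pow_le_pow_right (by omega) (by omega)).trans (Nat.le_mul_of_pos_left _ hk)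
    omega
  simp only [coordinatorProg, Timed.bind_time, sum_packets_val, sum_measurements_val, hval,
    ← hx']
  by_cases hd : k < x'.support.card
  · have := htotal 0 (Nat.zero_le _)
    simp only [denseProg, hd, decide_true, if_true, Timed.pure_time] at this ⊢
    omega
  · have hH := hashProg_time h hn hN ζ x' (A.report_range y)
    have hE := h.eqProg_time (hashProg ζ x').val (∑ t, (server A ζ (x t)).1)
    have hk' : x'.support.card * M ^ 16 ≤ k * M ^ 16 := by gcongr; omega
    have := htotal ((hashProg ζ x').time +
      (P.eqProg (hashProg ζ x').val (∑ t, (server A ζ (x t)).1)).time) (by omega)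
    simp only [denseProg, hd, decide_false, Bool.false_eq_true, if_false, Timed.bind_time,
      Timed.pure_time] at this ⊢
    omega

end DistProt

/-! ### Asymptotics in `n` -/

theorem one_le_logb_two {n : ℕ} (hn : 2 ≤ n) : 1 ≤ Real.logb 2 n := by
  rw [Real.le_logb_iff_rpow_le (by norm_num) (by positivity)]
  simpa using hn

theorem size_le_logb_add_one {n : ℕ} (hn : 2 ≤ n) : (Nat.size n : ℝ) ≤ Real.logb 2 n + 1 := by
  have hpos : 0 < Nat.size n := Nat.size_pos.2 (by omega)
  have h : 2 ^ (Nat.size n - 1) ≤ n := Nat.lt_size.1 (by omega)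
  have h' : ((Nat.size n - 1 : ℕ) : ℝ) ≤ Real.logb 2 n := by
    rw [Real.le_logb_iff_rpow_le (by norm_num) (by positivity), Real.rpow_natCast]
    exact_mod_cast h
  rw [Nat.cast_sub hpos] at h'
  push_cast at h'
  linarith

/-- All sizes are bounded by the product of the security parameter and `log n`, up to a
constant. -/
theorem GSWInstantiation.exists_sizeBound {P : ℕ → GSWParams} {S N : ℕ → ℕ}
    (hI : GSWInstantiation P S N) (hS : ∀ n, 2 ≤ n → 1 ≤ S n) :
    ∃ K : ℝ, 0 ≤ K ∧ ∀ n, 2 ≤ n → ∃ M : ℕ, (P (S n)).SizeBound M ∧ Nat.size n ≤ M ∧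
      (M : ℝ) ≤ K * (S n * Real.logb 2 n) := by
  obtain ⟨_, c, _, hc, hsamples⟩ := hI.samples
  obtain ⟨a, ha⟩ := hI.modulus_poly
  -- With `X = S n * log n ≥ 1`, the terms `4 + (g + 1) + size n` of `M` are at most `6 + S n + log
  -- n ≤ 8 X`; `c * a` comes from `h` and `2 * a` from `bits`.
  refine ⟨8 + c * a + 2 * a, by positivity, fun n hn => ?_⟩
  have hL := one_le_logb_two hn
  have hsize := size_le_logb_add_one hn
  have hκ : (1 : ℝ) ≤ S n := by exact_mod_cast hS n hn
  have hh := (hsamples (S n) (hS n hn)).2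
  have hdim := hI.dim (S n)
  have hq := ha n hn
  have hbits : (P (S n)).bits ≤ Nat.size n * a := by
    refine Nat.clog_le_of_le_pow (hq.trans ?_)
    rw [pow_mul]
    exact Nat.pow_le_pow_left (Nat.size_le.1 le_rfl).le a
  have hlogq : Real.logb 2 (P (S n)).q ≤ a * Real.logb 2 n := by
    have h2 := (P (S n)).two_le_q
    rw [← Real.logb_pow]
    exact Real.logb_le_logb_of_le (by norm_num) (by positivity) (by exact_mod_cast hq)
  generalize P (S n) = Q at *
  generalize Real.logb 2 n = L at *
  refine ⟨4 + (Q.g + 1) + Q.h + Q.bits + Nat.size n, ⟨?_, ?_, ?_, ?_⟩, ?_, ?_⟩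
  any_goals omega
  have hκL : (S n : ℝ) ≤ S n * L := le_mul_of_one_le_right (by linarith) hL
  have hLκ : L ≤ S n * L := le_mul_of_one_le_left (by linarith) hκ
  have h1 : (Q.h : ℝ) ≤ c * a * (S n * L) := by
    calc (Q.h : ℝ) ≤ c * (S n * Real.logb 2 Q.q) := hh
      _ ≤ c * (S n * (a * L)) := by gcongr
      _ = c * a * (S n * L) := by ring
  have h2 : (Q.bits : ℝ) ≤ 2 * a * (S n * L) := by
    calc (Q.bits : ℝ) ≤ Nat.size n * a := by exact_mod_cast hbits
      _ ≤ (2 * (S n * L)) * a := by gcongr; linarith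
      _ = 2 * a * (S n * L) := by ring
  push_cast
  rw [hdim]
  nlinarith

/-- The costs of the protocol are polynomial, of a fixed degree, in the security parameter. -/
theorem GSWInstantiation.hasCosts {P : ℕ → GSWParams} {S N : ℕ → ℕ} {F₁ F₂ F₃ : ℕ → ℝ}
    (hI : GSWInstantiation P S N) (hS : ∀ n, 2 ≤ n → 1 ≤ S n) (D : ℝ) (d : ℕ)
    (h₁ : ∀ n, 2 ≤ n → (S n : ℝ) ^ 18 ≤ D * Real.logb 2 n ^ d * F₁ n)
    (h₂ : ∀ n, 2 ≤ n → (S n : ℝ) ^ 18 ≤ D * Real.logb 2 n ^ d * F₂ n)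
    (h₃ : ∀ n, 2 ≤ n → (S n : ℝ) ^ 18 ≤ D * Real.logb 2 n ^ d * F₃ n) :
    HasCosts P S N F₁ F₂ F₃ := by
  obtain ⟨K, hK, hbound⟩ := hI.exists_sizeBound hS
  refine ⟨K ^ 18 * D, d + 18, fun n k hn hk hkn A ζ _ => ?_⟩
  obtain ⟨M, hM, hnM, hMle⟩ := hbound n hn
  have hL := one_le_logb_two hn
  have hM1 : (1 : ℝ) ≤ M := by exact_mod_cast (show 1 ≤ 4 by norm_num).trans hM.four_le
  have hNq : N n ≤ (P (S n)).q :=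
    (Nat.le_mul_of_pos_left _ (by omega)).trans (hI.modulus_large n hn).le
  -- Used with `s` equal to `1`, `n`, `k` or `T`; the highest exponent, `18`, occurs for the
  -- coordinator.
  have hpow : ∀ (F : ℕ → ℝ), (S n : ℝ) ^ 18 ≤ D * Real.logb 2 n ^ d * F n → ∀ (s e : ℕ), e ≤ 18 →
      ((s * M ^ e : ℕ) : ℝ) ≤ K ^ 18 * D * Real.logb 2 n ^ (d + 18) * (s * F n) := by
    intro F hF s e he
    push_cast
    calc (s : ℝ) * M ^ e ≤ s * M ^ 18 := by gcongr
      _ ≤ s * (K * (S n * Real.logb 2 n)) ^ 18 := by gcongr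
      _ = s * K ^ 18 * Real.logb 2 n ^ 18 * (S n : ℝ) ^ 18 := by ring
      _ ≤ s * K ^ 18 * Real.logb 2 n ^ 18 * (D * Real.logb 2 n ^ d * F n) := by gcongr
      _ = _ := by ring
  refine ⟨fun x hx => ⟨DistProt.serverProg_val A ζ x, ?_, ?_, fun hxk => ?_⟩,
    fun T x hx B hB => ⟨DistProt.coordinatorProg_val A ζ _, ?_⟩⟩
  · have h := hpow F₁ (h₁ n hn) 1 5 (by omega)
    rw [one_mul, Nat.cast_one, one_mul] at h
    have hc : (DistProt.communication A ζ (DistProt.server A ζ x) : ℝ) ≤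
        (M ^ 5 : ℕ) + measurementSize (A.Φ x) := by
      exact_mod_cast DistProt.communication_le hM hnM A ζ (DistProt.server A ζ x)
    linarith
  · have h := hpow F₃ (h₃ n hn) n 17 (by omega)
    have hc : ((DistProt.serverProg A ζ x).time : ℝ) ≤ (n * M ^ 17 : ℕ) + (A.measure x).time := by
      exact_mod_cast DistProt.serverProg_time hM hnM hNq A ζ x hx (by omega)
        (by simpa using x.support.card_le_univ)
    linarith
  · have h := hpow F₃ (h₃ n hn) k 17 (by omega)
    have hc : ((DistProt.serverProg A ζ x).time : ℝ) ≤ (k * M ^ 17 : ℕ) + (A.measure x).time := by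
      exact_mod_cast DistProt.serverProg_time hM hnM hNq A ζ x hx hk hxk
    linarith
  · have h := hpow F₂ (h₂ n hn) k 18 le_rfl
    have h' := hpow F₂ (h₂ n hn) T 6 (by omega)
    have hc : ((DistProt.coordinatorProg A ζ fun t => DistProt.server A ζ (x t)).time : ℝ) ≤
        (k * M ^ 18 : ℕ) + (A.report (A.Φ (∑ t, x t))).time + ((T * M ^ 6 : ℕ) + 2 * T * B) := by
      exact_mod_cast DistProt.coordinatorProg_time hM hnM hNq hk A ζ x hx hB
    linarith

theorem natCeil_pow_le {y : ℝ} (hy : 1 ≤ y) (e : ℕ) : ((⌈y⌉₊ : ℕ) : ℝ) ^ e ≤ 2 ^ e * y ^ e := by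
  rw [← mul_pow]
  have := (Nat.ceil_lt_add_one (show 0 ≤ y by linarith)).le
  gcongr
  linarith

theorem proposition5p3 :
    (∀ (β c r : ℝ), 0 < β → 0 < c → 1 / β < r → 1 / c < r →
      ∀ (P : ℕ → GSWParams) (N : ℕ → ℕ),
        SubexpLWEHard P β c →
        GSWInstantiation P (fun n => ⌈Real.logb 2 n ^ r⌉₊) N →
        HasCosts P (fun n => ⌈Real.logb 2 n ^ r⌉₊) N (fun _ => 1) (fun _ => 1) (fun _ => 1)) ∧
    (∀ w₁ w₂ w₃ : ℝ, 0 < w₁ → 0 < w₂ → 0 < w₃ →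
      ∃ w₀ : ℝ, 0 < w₀ ∧ ∀ w : ℝ, 0 < w → w ≤ w₀ →
        ∀ (P : ℕ → GSWParams) (N : ℕ → ℕ),
          PolyLWEHard P →
          GSWInstantiation P (fun n => ⌈(n : ℝ) ^ w⌉₊) N →
          HasCosts P (fun n => ⌈(n : ℝ) ^ w⌉₊) N
            (fun n => (n : ℝ) ^ w₁) (fun n => (n : ℝ) ^ w₂) (fun n => (n : ℝ) ^ w₃)) := by
  constructor
  · intro β c r hβ _ hr _ P N _ hI
    have hr0 : 0 < r := (one_div_pos.2 hβ).trans hr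
    have hy : ∀ n : ℕ, 2 ≤ n → 1 ≤ Real.logb 2 n ^ r := fun n hn =>
      Real.one_le_rpow (one_le_logb_two hn) hr0.le
    -- The exponent of the logarithm in `HasCosts` is a natural number, so `r` is rounded up.
    have key : ∀ n : ℕ, 2 ≤ n → ((⌈Real.logb 2 n ^ r⌉₊ : ℕ) : ℝ) ^ 18 ≤
        2 ^ 18 * Real.logb 2 n ^ (⌈r⌉₊ * 18) * 1 := by
      intro n hn
      have hL := one_le_logb_two hn
      refine (natCeil_pow_le (hy n hn) 18).trans ?_
      rw [mul_one, pow_mul, ← Real.rpow_natCast (Real.logb 2 n)]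
      gcongr
      exact Nat.le_ceil r
    exact hI.hasCosts (fun n hn => Nat.one_le_ceil_iff.2 (by linarith [hy n hn])) _ _ key key key
  · intro w₁ w₂ w₃ hw₁ hw₂ hw₃
    -- This choice makes `18 w` at most each of `w₁`, `w₂`, `w₃`.
    refine ⟨min w₁ (min w₂ w₃) / 18, by positivity, fun w hw hww P N _ hI => ?_⟩
    have hy : ∀ n : ℕ, 2 ≤ n → (1 : ℝ) ≤ (n : ℝ) ^ w := fun n hn =>
      Real.one_le_rpow (by exact_mod_cast (by omega : 1 ≤ n)) hw.le
    have key : ∀ v : ℝ, w * 18 ≤ v → ∀ n : ℕ, 2 ≤ n → ((⌈(n : ℝ) ^ w⌉₊ : ℕ) : ℝ) ^ 18 ≤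
        2 ^ 18 * Real.logb 2 n ^ 0 * (n : ℝ) ^ v := by
      intro v hv n hn
      have hn1 : (1 : ℝ) ≤ n := by exact_mod_cast (by omega : 1 ≤ n)
      refine (natCeil_pow_le (hy n hn) 18).trans ?_
      rw [pow_zero, mul_one, ← Real.rpow_mul_natCast (by linarith)]
      gcongr
      exact_mod_cast hv
    rw [le_div_iff₀ (by norm_num), le_min_iff, le_min_iff] at hww
    exact hI.hasCosts (fun n hn => Nat.one_le_ceil_iff.2 (by linarith [hy n hn])) _ _
      (key w₁ hww.1) (key w₂ hww.2.1) (key w₃ hww.2.2)
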